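/- Let $G$ be a finite simple connected graph of odd order $n$ (that is, with $n$ vertices, $n$ odd). Let $\tau(G)$ be the number of spanning trees of $G$, let $L(G)$ be the Laplacian matrix of $G$ (diagonal degree matrix minus adjacency matrix), and let $Q(G)=XX^{\top}$ be the signless Laplacian matrix of $G$, where $X$ is the $0,1$ vertex-edge incidence matrix (equivalently, $Q(G)$ is the degree matrix plus the adjacency matrix). Suppose that $\tau(G)$ is not divisible by $4$. Then: (i) $L(G)$ has no nonzero even integer eigenvalue; (ii) $Q(G)$ has no integer eigenvalue $\lambda\equiv 2\pmod 4$; (iii) $Q(G)$ has at most one integer eigenvalue $\lambda\equiv 0\pmod 4$ (the value $\lambda=0$ being included), and any such eigenvalue is simple, that is, a root of multiplicity $1$ of the characteristic polynomial of $Q(G)$. -/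

import Mathlib

namespace SimpleGraph

/-- The number `τ(G)` of spanning trees of `G`: a spanning tree is a tree on the whole vertex set
all of whose edges are edges of `G`. -/
noncomputable def numSpanningTrees {V : Type*} (G : SimpleGraph V) : ℕ :=
  Set.ncard {T : SimpleGraph V | T ≤ G ∧ T.IsTree}

/-- The signless Laplacian matrix `Q(G) = X Xᵀ`, where `X` is the `0,1` vertex-edge incidence
matrix of `G`. (The columns of Mathlib's `incMatrix` are indexed by all unordered pairs of
vertices; those that are not edges of `G` give zero columns, which do not contribute.) -/
noncomputable def signlessLapMatrix {V : Type*} [Fintype V] [DecidableEq V] (R : Type*)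
    [Semiring R] (G : SimpleGraph V) [DecidableRel G.Adj] : Matrix V V R :=
  G.incMatrix R * (G.incMatrix R).transpose

/-- `Q(G)` is the degree matrix plus the adjacency matrix. -/
theorem signlessLapMatrix_eq_degMatrix_add_adjMatrix {V : Type*} [Fintype V] [DecidableEq V]
    (R : Type*) [Semiring R] (G : SimpleGraph V) [DecidableRel G.Adj] :
    G.signlessLapMatrix R = G.degMatrix R + G.adjMatrix R := by
  rw [signlessLapMatrix, incMatrix_mul_transpose]
  ext a b
  by_cases h : a = b
  · subst h
    simp [degMatrix]
  · simp [degMatrix, h]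

end SimpleGraph

/-!
Let `n` be the number of vertices, `L`, `Q`, `A`, `D` the Laplacian, signless Laplacian, adjacency
and degree matrices, and `J` the all-ones matrix. The matrix-tree theorem gives
`det (L + J) = n² τ(G)` (`det_lapMatrix_add_one_eq`), so for odd `n` the hypothesis on `τ(G)` says
that `4` does not divide `det (L + J)`. On the other hand, if a symmetric integer matrix `M` has a
vector `z`, not zero modulo `2`, with `M z` even and `zᵀ M z` divisible by `4`, then `4 ∣ det M`
(`Matrix.four_dvd_det_of_isSymm`). Hence the key obstruction (`two_dvd_of_sum_even_of_lapMatrix`):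
an integer vector `z` with even coordinate sum, `L z` even and `4 ∣ zᵀ L z` is itself even.

An integer eigenvalue has an integer eigenvector `x` that is not even. If `L x = k x` with `k ≠ 0`
even, then `x` has coordinate sum zero, so `xᵀ x` is even and `4 ∣ xᵀ L x`, contradicting the
obstruction.

If `Q x = k x` with `k` even, then `L x = k x - 2 A x` is even and `xᵀ L x ≡ k xᵀ x` modulo `4`, so
the obstruction forces the coordinate sum of `x` to be odd. Summing `Q x = k x` over the vertices
then shows `4 ∣ k`, which excludes `k ≡ 2` modulo `4`. When `4 ∣ k`, the obstruction applies to `x`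
minus the all-ones vector, so every coordinate of `x` is odd. Two such eigenvectors have odd inner
product because `n` is odd, so they cannot belong to different eigenvalues; and a multiple
eigenvalue would have an eigenvector with a zero coordinate, which is not odd.

The matrix-tree theorem is proved without the Cauchy–Binet formula: expanding `det L`, with one row
replaced by a unit row, multilinearly in the rows gives a sum over maps choosing one neighbour for
each nonroot vertex. The terms are `1` for the parent maps of rooted spanning trees and `0` for all
other maps.
-/

open Finset Matrix

/-! ### Spanning trees and parent maps -/

namespace SimpleGraph

variable {V : Type*}

/-- A spanning tree of `G` rooted at `r`, encoded by the map sending each vertex to its parent.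
The root is its own parent, every other vertex is adjacent to its parent, and iterating the map
from any vertex arrives at the root. -/
structure IsParentMap (G : SimpleGraph V) (r : V) (f : V → V) : Prop where
  map_root : f r = r
  adj : ∀ v, v ≠ r → G.Adj v (f v)
  reaches : ∀ v, ∃ k, f^[k] v = r

/-- The graph joining each vertex `v` to `f v`; fixed points of `f` contribute no loop. -/
def ofParentMap (f : V → V) : SimpleGraph V := fromRel fun v w => f v = w

variable {G : SimpleGraph V} {r : V} {f g : V → V}

theorem ofParentMap_adj {v w : V} :
    (ofParentMap f).Adj v w ↔ v ≠ w ∧ (f v = w ∨ f w = v) := by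
  simp [ofParentMap]

theorem IsParentMap.ofParentMap_le (hf : G.IsParentMap r f) : ofParentMap f ≤ G := by
  have key : ∀ v w, v ≠ w → f v = w → G.Adj v w := by
    rintro v _ hne rfl
    refine hf.adj v ?_
    rintro rfl
    exact hne hf.map_root.symm
  intro v w h
  obtain ⟨hne, h | h⟩ := ofParentMap_adj.1 h
  · exact key v w hne h
  · exact (key w v hne.symm h).symm

theorem IsParentMap.connected_ofParentMap (hf : G.IsParentMap r f) :
    (ofParentMap f).Connected := by
  have hstep : ∀ v, (ofParentMap f).Reachable v (f v) := by
    intro v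
    by_cases h : v = f v
    · rw [← h]
    · exact (ofParentMap_adj.2 ⟨h, Or.inl rfl⟩).reachable
  have hiter : ∀ k v, (ofParentMap f).Reachable v (f^[k] v) := by
    intro k
    induction k with
    | zero => exact fun v => Reachable.refl v
    | succ k ih => exact fun v => (hstep v).trans (ih (f v))
  have hroot : ∀ v, (ofParentMap f).Reachable v r := by
    intro v
    obtain ⟨k, hk⟩ := hf.reaches v
    exact hk ▸ hiter k v
  have : Nonempty V := ⟨r⟩
  exact ⟨fun v w => (hroot v).trans (hroot w).symm⟩

theorem IsParentMap.isTree_ofParentMap [Finite V] (hf : G.IsParentMap r f) :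
    (ofParentMap f).IsTree := by
  classical
  have := Fintype.ofFinite V
  have hconn := hf.connected_ofParentMap
  refine isTree_iff_connected_and_card.2 ⟨hconn, le_antisymm ?_
    hconn.card_vert_le_card_edgeSet_add_one⟩
  have hsub : (ofParentMap f).edgeSet ⊆
      ((univ.erase r).image fun v => s(v, f v) : Finset (Sym2 V)) := by
    intro e
    induction e with
    | h v w =>
      intro h
      obtain ⟨hne, h | h⟩ := ofParentMap_adj.1 h
      · simp only [coe_image, Set.mem_image]
        refine ⟨v, ?_, by rw [h]⟩
        simp only [coe_erase, coe_univ, Set.mem_sdiff, Set.mem_univ, true_and,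
          Set.mem_singleton_iff]
        rintro rfl
        exact hne (hf.map_root.symm.trans h)
      · simp only [coe_image, Set.mem_image]
        refine ⟨w, ?_, by rw [h, Sym2.eq_swap]⟩
        simp only [coe_erase, coe_univ, Set.mem_sdiff, Set.mem_univ, true_and,
          Set.mem_singleton_iff]
        rintro rfl
        exact hne (h.symm.trans hf.map_root)
  have h1 := Set.ncard_le_ncard hsub (Finset.finite_toSet _)
  rw [Set.ncard_coe_finset] at h1
  have h2 := h1.trans card_image_le
  rw [card_erase_of_mem (mem_univ r), card_univ] at h2
  rw [Nat.card_coe_set_eq, Nat.card_eq_fintype_card]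
  have : 0 < Fintype.card V := Fintype.card_pos_iff.2 ⟨r⟩
  omega

/-- A rooted tree determines its parent map: if `f v ≠ g v` while both maps give the same graph,
then `f` reverses the `g`-edge at `v`, so `f` and `g` differ at `g v` too, and hence all the way up
to the root, where they agree. -/
theorem IsParentMap.eq_of_ofParentMap_eq (hf : G.IsParentMap r f) (hg : G.IsParentMap r g)
    (h : ofParentMap f = ofParentMap g) : f = g := by
  by_contra hne
  obtain ⟨v, hv⟩ := Function.ne_iff.1 hne
  have step : ∀ v, f v ≠ g v → f (g v) ≠ g (g v) := by
    intro v hv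
    have hvr : v ≠ r := by
      rintro rfl
      exact hv (hf.map_root.trans hg.map_root.symm)
    have hadj : (ofParentMap f).Adj v (g v) := by
      rw [h]
      exact ofParentMap_adj.2 ⟨(hg.adj v hvr).ne, Or.inl rfl⟩
    have hfg : f (g v) = v := (ofParentMap_adj.1 hadj).2.resolve_left hv
    rw [hfg]
    -- otherwise `g` would swap `v` and `g v` and never arrive at the root
    intro hgg
    obtain ⟨k, hk⟩ := hg.reaches v
    have horb : ∀ k, g^[k] v = v ∨ g^[k] v = g v := by
      intro k
      induction k with
      | zero => exact Or.inl rfl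
      | succ k ih =>
        rw [Function.iterate_succ_apply']
        rcases ih with ih | ih
        · right; rw [ih]
        · left; rw [ih, ← hgg]
    rcases horb k with h' | h'
    · exact hvr (h'.symm.trans hk)
    · apply hvr
      rw [← hfg, h'.symm.trans hk, hf.map_root]
  have hall : ∀ k, f (g^[k] v) ≠ g (g^[k] v) := by
    intro k
    induction k with
    | zero => exact hv
    | succ k ih =>
      rw [Function.iterate_succ_apply']
      exact step _ ih
  obtain ⟨k, hk⟩ := hg.reaches v
  apply hall k
  rw [hk, hf.map_root, hg.map_root]

/-- Every spanning tree arises from a parent map: the parent of `v` is the next vertex on a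
shortest path to the root. -/
theorem IsTree.exists_isParentMap {T : SimpleGraph V} (hT : T.IsTree) (hle : T ≤ G) (r : V) :
    ∃ f, G.IsParentMap r f ∧ ofParentMap f = T := by
  classical
  have hex : ∀ v, ∃ u, (v = r → u = r) ∧ (v ≠ r → T.Adj v u ∧ T.dist u r < T.dist v r) := by
    intro v
    by_cases hv : v = r
    · exact ⟨r, fun _ => rfl, fun h => absurd hv h⟩
    · obtain ⟨p, hp⟩ := hT.connected.exists_walk_length_eq_dist v r
      cases p with
      | nil => exact absurd rfl hv
      | cons hadj q =>
        refine ⟨_, fun h => absurd h hv, fun _ => ⟨hadj, ?_⟩⟩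
        rw [← hp, Walk.length_cons]
        exact Nat.lt_succ_of_le (dist_le q)
  choose f hfr hf using hex
  have key : ∀ n v, T.dist v r = n → ∃ k, f^[k] v = r := by
    intro n
    induction n using Nat.strong_induction_on with
    | _ n ih =>
      intro v hv
      by_cases hvr : v = r
      · exact ⟨0, hvr⟩
      · obtain ⟨k, hk⟩ := ih _ (hv ▸ (hf v hvr).2) (f v) rfl
        exact ⟨k + 1, hk⟩
  have hT' : T.IsParentMap r f := ⟨hfr r rfl, fun v hv => (hf v hv).1, fun v => key _ v rfl⟩
  refine ⟨f, ⟨hT'.map_root, fun v hv => hle (hT'.adj v hv), hT'.reaches⟩, ?_⟩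
  exact le_antisymm hT'.ofParentMap_le
    ((isTree_iff_minimal_connected.1 hT).2 hT'.connected_ofParentMap hT'.ofParentMap_le)

theorem numSpanningTrees_eq_ncard_isParentMap [Finite V] (G : SimpleGraph V) (r : V) :
    G.numSpanningTrees = Set.ncard {f : V → V | G.IsParentMap r f} := by
  symm
  refine Set.ncard_congr (fun f _ => ofParentMap f) ?_ ?_ ?_
  · exact fun f hf => ⟨hf.ofParentMap_le, hf.isTree_ofParentMap⟩
  · exact fun f g hf hg h => hf.eq_of_ofParentMap_eq hg h
  · rintro T ⟨hle, hT⟩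
    obtain ⟨f, hf, h⟩ := hT.exists_isParentMap hle r
    exact ⟨f, hf, h⟩

/-! ### The matrix-tree theorem -/

/-- The row indexed by `v` of the matrix expressing that `u` is the parent of `v`: the row of the
oriented edge `v → u`, or the unit row when `v` is the root `r`. -/
def edgeRow [DecidableEq V] (r v u : V) : V → ℤ :=
  if v = r then Pi.single r 1 else Pi.single v 1 - Pi.single u 1

variable [Fintype V] [DecidableEq V]

theorem edgeRow_dotProduct (r v u : V) (x : V → ℤ) :
    edgeRow r v u ⬝ᵥ x = if v = r then x r else x v - x u := by
  unfold edgeRow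
  split_ifs <;> simp [sub_dotProduct]

/-- If every vertex reaches the root under `f`, the matrix is the identity minus a nilpotent
matrix, so it has determinant `1`. -/
theorem det_edgeRow_eq_one (h : ∀ v, ∃ k, f^[k] v = r) :
    (Matrix.of fun v => edgeRow r v (f v)).det = 1 := by
  set B : Matrix V V ℤ := Matrix.of fun v => edgeRow r v (f v) with hB
  have hA : ∀ (x : V → ℤ) v, ((1 - B) *ᵥ x) v = if v = r then 0 else x (f v) := by
    intro x v
    have : (B *ᵥ x) v = _ := edgeRow_dotProduct r v (f v) x
    rw [sub_mulVec, Pi.sub_apply, this, one_mulVec]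
    split_ifs with h
    · simp [h]
    · ring
  -- the `m`-th power transports a vector along `f^[m]`, and the root row kills it
  have hpow : ∀ (x : V → ℤ) m k v, k < m → f^[k] v = r → (((1 - B) ^ m) *ᵥ x) v = 0 := by
    intro x m
    induction m with
    | zero => intro k v hk; omega
    | succ m ih =>
      intro k v hk hv
      rw [pow_succ', ← mulVec_mulVec, hA]
      split_ifs with hvr
      · rfl
      · cases k with
        | zero => exact absurd hv hvr
        | succ k => exact ih k (f v) (by omega) hv
  choose k hk using h
  have hnil : IsNilpotent (1 - B) := by
    refine ⟨(univ.sup k) + 1, ?_⟩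
    refine Matrix.ext_of_mulVec_single fun i => ?_
    ext v
    rw [hpow _ _ (k v) v (Nat.lt_succ_of_le (le_sup (mem_univ v))) (hk v)]
    simp
  have hchar := Matrix.isNilpotent_charpoly_sub_pow_of_isNilpotent hnil
  have hchar' : (1 - B).charpoly = Polynomial.X ^ Fintype.card V := sub_eq_zero.1 hchar.eq_zero
  have := Matrix.eval_charpoly (1 - B) 1
  rw [hchar'] at this
  simpa using this.symm

/-- If some vertex never reaches the root under `f`, the indicator of the set of all such vertices
is in the kernel. -/
theorem det_edgeRow_eq_zero (h : ¬ ∀ v, ∃ k, f^[k] v = r) :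
    (Matrix.of fun v => edgeRow r v (f v)).det = 0 := by
  classical
  push Not at h
  obtain ⟨v, hv⟩ := h
  refine exists_mulVec_eq_zero_iff.1
    ⟨fun w => if ∃ k, f^[k] w = r then 0 else 1, ?_, ?_⟩
  · intro h0
    have := congrFun h0 v
    simp [hv] at this
  · ext w
    have : ∀ x, ((Matrix.of fun v => edgeRow r v (f v)) *ᵥ x) w = _ :=
      edgeRow_dotProduct r w (f w)
    rw [this, Pi.zero_apply]
    by_cases hw : w = r
    · rw [if_pos hw, if_pos ⟨0, rfl⟩]
    · have hiff : (∃ k, f^[k] w = r) ↔ ∃ k, f^[k] (f w) = r := by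
        constructor
        · rintro ⟨k, hk⟩
          cases k with
          | zero => exact absurd hk hw
          | succ k => exact ⟨k, hk⟩
        · rintro ⟨k, hk⟩
          exact ⟨k + 1, hk⟩
      simp only [if_neg hw, hiff, sub_self]

variable (G) [DecidableRel G.Adj]

/-- The matrix-tree theorem. Each nonroot row of the Laplacian is the sum of the edge rows at that
vertex, so by multilinearity the determinant is the sum, over all choices of one neighbour per
nonroot vertex, of determinants that are `1` for parent maps and `0` otherwise. -/
theorem det_lapMatrix_updateRow_eq_numSpanningTrees (r : V) :
    ((G.lapMatrix ℤ).updateRow r (Pi.single r 1)).det = G.numSpanningTrees := by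
  classical
  let S : V → Finset V := fun v => if v = r then {r} else G.neighborFinset v
  have hrow : (G.lapMatrix ℤ).updateRow r (Pi.single r 1) =
      Matrix.of fun v => ∑ u ∈ S v, edgeRow r v u := by
    ext v w
    rw [updateRow_apply, of_apply, Finset.sum_apply]
    by_cases hv : v = r
    · subst hv; simp [S, edgeRow]
    · have hS : S v = G.neighborFinset v := if_neg hv
      have he : ∀ u, edgeRow r v u w = (Pi.single v 1 : V → ℤ) w - (Pi.single u 1 : V → ℤ) w :=
        fun u => congrFun (if_neg hv) w
      simp_rw [if_neg hv, hS, he, sum_sub_distrib, sum_const, lapMatrix, Matrix.sub_apply,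
        degMatrix, adjMatrix_apply, card_neighborFinset_eq_degree]
      congr 1
      · by_cases hvw : v = w
        · subst hvw; simp
        · simp [hvw, Ne.symm hvw]
      · simp [Pi.single_apply]
  have hexp : (Matrix.of fun v => ∑ u ∈ S v, edgeRow r v u).det =
      ∑ f ∈ Fintype.piFinset S, (Matrix.of fun v => edgeRow r v (f v)).det :=
    (detRowAlternating (R := ℤ) (n := V)).toMultilinearMap.map_sum_finset
      (fun v u => edgeRow r v u) S
  have hmem : ∀ f, f ∈ Fintype.piFinset S ↔ f r = r ∧ ∀ v, v ≠ r → G.Adj v (f v) := by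
    intro f
    rw [Fintype.mem_piFinset]
    constructor
    · intro h
      refine ⟨by simpa [S] using h r, fun v hv => by simpa [S, hv] using h v⟩
    · rintro ⟨h1, h2⟩ v
      by_cases hv : v = r
      · subst hv; simpa [S] using h1
      · simpa [S, hv] using h2 v hv
  rw [hrow, hexp, numSpanningTrees_eq_ncard_isParentMap G r]
  have hset : {f : V → V | G.IsParentMap r f} =
      ((Fintype.piFinset S).filter fun f => ∀ v, ∃ k, f^[k] v = r : Finset (V → V)) := by
    ext f
    simp only [Set.mem_ofPred_eq, coe_filter, hmem]
    exact ⟨fun h => ⟨⟨h.map_root, h.adj⟩, h.reaches⟩, fun h => ⟨h.1.1, h.1.2, h.2⟩⟩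
  rw [hset, Set.ncard_coe_finset, card_filter, Nat.cast_sum]
  refine sum_congr rfl fun f _ => ?_
  split_ifs with h
  · rw [det_edgeRow_eq_one h]; rfl
  · rw [det_edgeRow_eq_zero h]; rfl

theorem sum_lapMatrix_row (v : V) : ∑ w, G.lapMatrix ℤ v w = 0 := by
  have := congrFun (G.lapMatrix_mulVec_const_eq_zero (R := ℤ)) v
  simpa [mulVec, dotProduct] using this

theorem sum_lapMatrix_col (w : V) : ∑ v, G.lapMatrix ℤ v w = 0 := by
  simp_rw [fun v => ((G.isSymm_lapMatrix ℤ).apply v w).symm]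
  exact G.sum_lapMatrix_row w

/-- The matrix-tree theorem in symmetric form, with the all-ones matrix added to the Laplacian. -/
theorem det_lapMatrix_add_one_eq [Nonempty V] :
    (G.lapMatrix ℤ + Matrix.of fun _ _ => 1).det =
      (Fintype.card V : ℤ) ^ 2 * G.numSpanningTrees := by
  obtain ⟨r⟩ := ‹Nonempty V›
  set M : Matrix V V ℤ := G.lapMatrix ℤ + Matrix.of fun _ _ => 1 with hM
  set N : Matrix V V ℤ := (G.lapMatrix ℤ).updateRow r 1 with hN
  -- replace row `r` by the sum of all rows, then subtract the all-ones row from the others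
  have h1 : M.det = Fintype.card V * N.det := by
    have ha := det_updateRow_sum M r 1
    have hb : ∑ k, (1 : V → ℤ) k • M k = (Fintype.card V : ℤ) • (1 : V → ℤ) := by
      ext w
      have hsum : ∑ v, M v w = Fintype.card V := by
        simp [hM, sum_add_distrib, G.sum_lapMatrix_col w]
      refine (Finset.sum_apply w univ fun k => (1 : V → ℤ) k • M k).trans ?_
      simpa using hsum
    rw [hb, det_updateRow_smul, Pi.one_apply, one_smul] at ha
    rw [← ha]
    congr 1
    refine det_eq_of_forall_row_eq_smul_add_const (fun v => if v = r then 0 else 1) r (by simp) ?_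
    intro v w
    by_cases hv : v = r <;> simp [hN, hM, hv, updateRow_apply]
  -- replace column `r` by the sum of all columns
  have h2 : N.det = Fintype.card V * (N.updateCol r (Pi.single r 1)).det := by
    have ha := det_updateCol_sum N r 1
    have hb : (fun k => ∑ i, (1 : V → ℤ) i • N k i) =
        (Fintype.card V : ℤ) • (Pi.single r 1 : V → ℤ) := by
      ext v
      have := G.sum_lapMatrix_row v
      by_cases hv : v = r
      · subst hv; simp [hN]
      · simp [hN, updateRow_apply, hv, this]
    rw [hb, det_updateCol_smul, Pi.one_apply, one_smul] at ha
    exact ha.symm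
  have h3 : (N.updateCol r (Pi.single r 1)).det =
      ((G.lapMatrix ℤ).updateRow r (Pi.single r 1)).det := by
    have ha : (N.updateCol r (Pi.single r 1)).det = adjugate N r r := by
      rw [← cramer_apply, ← transpose_apply (adjugate N), adjugate_transpose, adjugate_def]
      simp
    rw [ha, adjugate_apply, hN, updateRow_idem]
  rw [h1, h2, h3, det_lapMatrix_updateRow_eq_numSpanningTrees]
  ring

end SimpleGraph

/-! ### Determinants and quadratic forms modulo powers of two -/

namespace Matrix
variable {V : Type*} [Fintype V] [DecidableEq V]

theorem two_dvd_det_of_forall_even_row {N : Matrix V V ℤ} (i : V) (h : ∀ j, 2 ∣ N i j) :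
    2 ∣ N.det := by
  choose c hc using h
  have : N = N.updateRow i ((2 : ℤ) • c) := by
    ext v w
    by_cases hv : v = i
    · subst hv; simp [hc]
    · simp [updateRow_apply, hv]
  rw [this, det_updateRow_smul]
  exact Dvd.intro _ rfl

/-- If `z` is nonzero modulo `2` and in the kernel of `M` modulo `2`, and its value under the
quadratic form of `M` is divisible by `4`, then `4 ∣ det M`: after a change of basis bringing `z`
into the basis, `M` has an even row and an even column that meet in a multiple of `4`. -/
theorem four_dvd_det_of_isSymm {M : Matrix V V ℤ} (hM : M.IsSymm) {z : V → ℤ}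
    (hz : ∃ i, ¬ 2 ∣ z i) (heven : ∀ v, 2 ∣ (M *ᵥ z) v) (hquad : 4 ∣ z ⬝ᵥ (M *ᵥ z)) :
    4 ∣ M.det := by
  obtain ⟨i, hi⟩ := hz
  choose c hc using heven
  have hMz : M *ᵥ z = (2 : ℤ) • c := funext fun v => by simp [hc]
  -- up to the odd factor `z i`, column `i` may be replaced by `M z = 2 c`
  have h1 : z i * M.det = 2 * (M.updateCol i c).det := by
    rw [← det_updateCol_smul, ← hMz, ← smul_eq_mul, ← det_updateCol_sum M i z]
    congr 2
    ext v
    simp [mulVec, dotProduct, mul_comm]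
  -- likewise row `i` may be replaced by the combination with coefficients `z`, which is even
  have h2 : (2 : ℤ) ∣ z i * (M.updateCol i c).det := by
    rw [← smul_eq_mul, ← det_updateRow_sum]
    refine two_dvd_det_of_forall_even_row i fun j => ?_
    rw [updateRow_self, Finset.sum_apply]
    by_cases hj : j = i
    · subst hj
      have : ∑ v, (z v • M.updateCol j c v) j = z ⬝ᵥ c := by
        simp [dotProduct]
      rw [this]
      rw [hMz, dotProduct_smul, smul_eq_mul] at hquad
      omega
    · have : ∑ v, (z v • M.updateCol i c v) j = (M *ᵥ z) j := by
        simp only [Pi.smul_apply, smul_eq_mul, updateCol_apply, if_neg hj, mulVec, dotProduct]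
        exact sum_congr rfl fun v _ => by rw [mul_comm, hM.apply]
      rw [this, hc]
      exact Dvd.intro _ rfl
  have hcop2 : IsCoprime (2 : ℤ) (z i) := (Int.prime_two.coprime_iff_not_dvd).2 hi
  have hcop : IsCoprime (4 : ℤ) (z i) := by simpa using hcop2.pow_left (m := 2)
  have h3 := hcop2.dvd_of_dvd_mul_left h2
  refine hcop.dvd_of_dvd_mul_left ?_
  rw [h1]
  exact mul_dvd_mul_left 2 h3

omit [DecidableEq V] in
/-- The off-diagonal terms of the quadratic form of a symmetric matrix come in equal pairs. -/
theorem even_dotProduct_mulVec {A : Matrix V V ℤ} (hA : A.IsSymm) (hd : ∀ v, A v v = 0)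
    (x : V → ℤ) : 2 ∣ x ⬝ᵥ (A *ᵥ x) := by
  rw [← Nat.cast_two, ← ZMod.intCast_zmod_eq_zero_iff_dvd]
  simp only [dotProduct, mulVec, mul_sum]
  rw [← Fintype.sum_prod_type' (f := fun v w => x v * (A v w * x w)), Int.cast_sum]
  refine sum_involution (fun p _ => p.swap) ?_ ?_ ?_ ?_
  · rintro ⟨v, w⟩ -
    simp only [Prod.swap]
    rw [hA.apply v w, ← Int.cast_add, ZMod.intCast_zmod_eq_zero_iff_dvd]
    exact ⟨x v * (A v w * x w), by push_cast; ring⟩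
  · rintro ⟨v, w⟩ - hne heq
    obtain rfl : w = v := congrArg Prod.fst heq
    simp [hd] at hne
  · simp
  · simp

/-! ### Integral eigenvectors -/

/-- An integer matrix with a nonzero real kernel vector has an integer kernel vector that is
nonzero modulo `2`: its determinant vanishes, which yields an integer kernel vector, and the gcd
of the entries can be divided out. -/
theorem exists_int_mulVec_eq_zero {A : Matrix V V ℤ} {x : V → ℝ} (hx : x ≠ 0)
    (h : A.map (Int.cast : ℤ → ℝ) *ᵥ x = 0) :
    ∃ y : V → ℤ, (∃ i, ¬ 2 ∣ y i) ∧ A *ᵥ y = 0 := by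
  have hdet : (A.map (Int.cast : ℤ → ℝ)).det = 0 := exists_mulVec_eq_zero_iff.1 ⟨x, hx, h⟩
  have hdet' : A.det = 0 := by
    have h1 := (Int.castRingHom ℝ).map_det A
    have h2 : (Int.castRingHom ℝ).mapMatrix A = A.map (Int.cast : ℤ → ℝ) := rfl
    rw [h2, hdet] at h1
    exact Int.cast_eq_zero.1 h1
  obtain ⟨y, hy, hAy⟩ := exists_mulVec_eq_zero_iff.2 hdet'
  obtain ⟨i, hi⟩ := Function.ne_iff.1 hy
  obtain ⟨g, hg, hg1⟩ := Finset.extract_gcd y ⟨i, mem_univ i⟩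
  have hy' : y = univ.gcd y • g := funext fun v => hg v (mem_univ v)
  have hd : univ.gcd y ≠ 0 := fun h0 => hi (Finset.gcd_eq_zero_iff.1 h0 i (mem_univ i))
  refine ⟨g, ?_, ?_⟩
  · by_contra! hall
    have : (2 : ℤ) ∣ univ.gcd g := Finset.dvd_gcd fun v _ => hall v
    rw [hg1] at this
    norm_num at this
  · rw [hy', mulVec_smul] at hAy
    exact (smul_eq_zero.1 hAy).resolve_left hd

theorem exists_int_eigenvector {A : Matrix V V ℤ} {B : Matrix V V ℝ}
    (hB : A.map (Int.cast : ℤ → ℝ) = B) {k : ℤ}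
    (h : Module.End.HasEigenvalue (Matrix.toLin' B) (k : ℝ)) :
    ∃ y : V → ℤ, (∃ i, ¬ 2 ∣ y i) ∧ A *ᵥ y = k • y := by
  obtain ⟨x, hx⟩ := h.exists_hasEigenvector
  have hx1 : B *ᵥ x = (k : ℝ) • x := by simpa using hx.apply_eq_smul
  obtain ⟨y, hy, hAy⟩ := exists_int_mulVec_eq_zero (A := A - k • (1 : Matrix V V ℤ)) hx.2 (by
    have : (A - k • (1 : Matrix V V ℤ)).map (Int.cast : ℤ → ℝ) =
        B - (k : ℝ) • (1 : Matrix V V ℝ) := by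
      rw [← hB]
      ext v w
      simp only [map_apply, Matrix.sub_apply, Matrix.smul_apply, one_apply]
      split_ifs <;> simp
    rw [this, sub_mulVec, smul_mulVec, one_mulVec, hx1, sub_self])
  refine ⟨y, hy, ?_⟩
  rw [sub_mulVec, smul_mulVec, one_mulVec] at hAy
  exact sub_eq_zero.1 hAy

/-- For a symmetric integer matrix `A`, a real `k`-eigenvector vanishing at `i` can be replaced by
an integer one that is nonzero modulo `2`. The condition at `i` is absorbed into the single matrix
`(A - k)² + eᵢ eᵢᵀ`, whose kernel consists of the `k`-eigenvectors vanishing at `i`. -/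
theorem exists_int_eigenvector_of_apply_eq_zero {A : Matrix V V ℤ} (hA : A.IsSymm)
    {B : Matrix V V ℝ} (hB : A.map (Int.cast : ℤ → ℝ) = B) {k : ℤ} {x : V → ℝ} (hx : x ≠ 0)
    (hBx : B *ᵥ x = (k : ℝ) • x) {i : V} (hxi : x i = 0) :
    ∃ y : V → ℤ, (∃ i, ¬ 2 ∣ y i) ∧ A *ᵥ y = k • y ∧ y i = 0 := by
  set C : Matrix V V ℤ := A - k • (1 : Matrix V V ℤ) with hC
  have hCB : C.map (Int.cast : ℤ → ℝ) = B - (k : ℝ) • (1 : Matrix V V ℝ) := by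
    rw [← hB]
    ext v w
    simp only [hC, map_apply, Matrix.sub_apply, Matrix.smul_apply, one_apply]
    split_ifs <;> simp
  have hCsymm : C.IsSymm := hA.sub (isSymm_one.smul k)
  obtain ⟨y, hy, hDy⟩ := exists_int_mulVec_eq_zero (A := C * C + diagonal (Pi.single i 1)) hx (by
    have : (C * C + diagonal (Pi.single i 1)).map (Int.cast : ℤ → ℝ) =
        C.map (Int.cast : ℤ → ℝ) * C.map (Int.cast : ℤ → ℝ) + diagonal (Pi.single i 1) := by
      ext v w
      by_cases hv : v = w <;> by_cases hvi : v = i <;>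
        simp [mul_apply, hv, hvi, diagonal_apply, Pi.single_apply]
    rw [this, add_mulVec, ← mulVec_mulVec, hCB, sub_mulVec _ _ x, smul_mulVec, one_mulVec, hBx,
      sub_self, mulVec_zero, zero_add]
    ext v
    rw [mulVec_diagonal]
    by_cases hv : v = i
    · subst hv; simp [hxi]
    · simp [hv])
  refine ⟨y, hy, ?_⟩
  have hq : (C *ᵥ y) ⬝ᵥ (C *ᵥ y) + y i * y i = 0 := by
    have := congrArg (y ⬝ᵥ ·) hDy
    simp only [add_mulVec, dotProduct_add, dotProduct_zero, ← mulVec_mulVec] at this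
    rw [dotProduct_mulVec, ← mulVec_transpose, hCsymm.eq] at this
    rw [← this]
    congr 1
    simp [dotProduct, mulVec_diagonal, Pi.single_apply]
  have h1 : 0 ≤ (C *ᵥ y) ⬝ᵥ (C *ᵥ y) := sum_nonneg fun v _ => mul_self_nonneg _
  have h2 := mul_self_nonneg (y i)
  have h3 : C *ᵥ y = 0 := dotProduct_self_eq_zero.1 (by linarith)
  have h4 : y i = 0 := mul_self_eq_zero.1 (by linarith)
  rw [hC, sub_mulVec, smul_mulVec, one_mulVec] at h3
  exact ⟨sub_eq_zero.1 h3, h4⟩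

/-- A multiple root of the characteristic polynomial of a real symmetric matrix has an eigenspace
of dimension at least `2`, which therefore meets every coordinate hyperplane nontrivially. -/
theorem IsHermitian.exists_eigenvector_apply_eq_zero {B : Matrix V V ℝ} (hB : B.IsHermitian)
    {k : ℝ} (h : 1 < B.charpoly.rootMultiplicity k) (i : V) :
    ∃ x : V → ℝ, x ≠ 0 ∧ B *ᵥ x = k • x ∧ x i = 0 := by
  have hcard : 1 < #{j | hB.eigenvalues j = k} := by
    rw [← Polynomial.count_roots, hB.roots_charpoly_eq_eigenvalues, Multiset.count_map] at h
    convert h using 2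
    rw [Finset.card_def, Finset.filter_val]
    congr 1
    exact Multiset.filter_congr fun j _ => by simp [eq_comm]
  obtain ⟨a, ha, b, hb, hab⟩ := one_lt_card.1 hcard
  simp only [mem_filter, mem_univ, true_and] at ha hb
  have hva := hB.mulVec_eigenvectorBasis a
  have hvb := hB.mulVec_eigenvectorBasis b
  rw [ha] at hva
  rw [hb] at hvb
  set u : V → ℝ := ⇑(hB.eigenvectorBasis a) with hu
  set w : V → ℝ := ⇑(hB.eigenvectorBasis b) with hw
  have hlin : ∀ s t : ℝ, s • u + t • w = 0 → s = 0 ∧ t = 0 := by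
    intro s t hst
    have hst' : s • hB.eigenvectorBasis a + t • hB.eigenvectorBasis b = 0 := by
      ext j
      exact congrFun hst j
    have horth := orthonormal_iff_ite.1 hB.eigenvectorBasis.orthonormal
    have h1 := congrArg (inner ℝ (hB.eigenvectorBasis a)) hst'
    have h2 := congrArg (inner ℝ (hB.eigenvectorBasis b)) hst'
    rw [inner_add_right, inner_smul_right, inner_smul_right, inner_zero_right, horth, horth] at h1 h2
    simp only [if_true, if_neg hab, if_neg hab.symm] at h1 h2
    constructor <;> linarith
  by_cases hui : u i = 0
  · exact ⟨u, fun h0 => one_ne_zero (hlin 1 0 (by simp [h0])).1, hva, hui⟩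
  · refine ⟨w i • u - u i • w, fun h0 => hui ?_, ?_, ?_⟩
    · simpa using (hlin (w i) (-u i) (by rw [neg_smul, ← sub_eq_add_neg, h0])).2
    · rw [mulVec_sub, mulVec_smul, mulVec_smul, hva, hvb]
      module
    · simp [mul_comm]

end Matrix

/-! ### Parity of Laplacian and signless Laplacian eigenvectors -/

namespace SimpleGraph

variable {V : Type*} [Fintype V] [DecidableEq V] (G : SimpleGraph V) [DecidableRel G.Adj]

theorem isSymm_signlessLapMatrix : (G.signlessLapMatrix ℤ).IsSymm := by
  rw [signlessLapMatrix_eq_degMatrix_add_adjMatrix]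
  exact (G.isSymm_degMatrix ℤ).add G.isSymm_adjMatrix

theorem map_lapMatrix : (G.lapMatrix ℤ).map (Int.cast : ℤ → ℝ) = G.lapMatrix ℝ := by
  ext v w
  simp only [map_apply, lapMatrix, degMatrix, Matrix.sub_apply, diagonal_apply, adjMatrix_apply]
  split_ifs <;> simp

theorem map_signlessLapMatrix :
    (G.signlessLapMatrix ℤ).map (Int.cast : ℤ → ℝ) = G.signlessLapMatrix ℝ := by
  ext v w
  simp only [signlessLapMatrix_eq_degMatrix_add_adjMatrix, map_apply, degMatrix, Matrix.add_apply,
    diagonal_apply, adjMatrix_apply]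
  split_ifs <;> simp

theorem isHermitian_signlessLapMatrix : (G.signlessLapMatrix ℝ).IsHermitian := by
  rw [← map_signlessLapMatrix]
  ext v w
  simp [G.isSymm_signlessLapMatrix.apply]

theorem sum_signlessLapMatrix_mulVec (x : V → ℤ) :
    ∑ v, (G.signlessLapMatrix ℤ *ᵥ x) v = 2 * ∑ v, G.degree v * x v := by
  have h : ∑ v, (G.adjMatrix ℤ *ᵥ x) v = ∑ v, G.degree v * x v := by
    simp only [mulVec, dotProduct]
    rw [sum_comm]
    refine sum_congr rfl fun v _ => ?_
    rw [← sum_mul, degree_eq_sum_if_adj]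
    simp only [adjMatrix_apply, G.adj_comm v]
  simp only [signlessLapMatrix_eq_degMatrix_add_adjMatrix, add_mulVec, Pi.add_apply,
    sum_add_distrib, h, degMatrix_mulVec_apply]
  ring

omit [DecidableEq V] in
theorem even_dotProduct_adjMatrix_mulVec (x : V → ℤ) : 2 ∣ x ⬝ᵥ (G.adjMatrix ℤ *ᵥ x) :=
  even_dotProduct_mulVec G.isSymm_adjMatrix (by simp) x

/-- The sum of the integer Laplacian and the all-ones matrix. -/
def lapAddOnes : Matrix V V ℤ := G.lapMatrix ℤ + Matrix.of fun _ _ => 1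

theorem isSymm_lapAddOnes : G.lapAddOnes.IsSymm :=
  (G.isSymm_lapMatrix ℤ).add (by ext; rfl)

theorem lapAddOnes_mulVec (x : V → ℤ) :
    G.lapAddOnes *ᵥ x = G.lapMatrix ℤ *ᵥ x + fun _ => ∑ w, x w := by
  rw [lapAddOnes, add_mulVec]
  congr 1
  ext v
  simp [mulVec, dotProduct]

theorem lapMatrix_mulVec_eq_signless (x : V → ℤ) :
    G.lapMatrix ℤ *ᵥ x = G.signlessLapMatrix ℤ *ᵥ x - (2 : ℤ) • (G.adjMatrix ℤ *ᵥ x) := by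
  rw [signlessLapMatrix_eq_degMatrix_add_adjMatrix, lapMatrix, sub_mulVec, add_mulVec]
  module

omit [DecidableEq V] in
/-- Squares may be replaced by their bases modulo `2`. -/
theorem two_dvd_sum_mul_sq_sub (c x : V → ℤ) : 2 ∣ ∑ v, c v * (x v * x v) - ∑ v, c v * x v := by
  rw [← sum_sub_distrib]
  refine dvd_sum fun v _ => ?_
  rw [← mul_sub]
  refine Dvd.dvd.mul_left ?_ _
  have := Int.even_mul_pred_self (x v)
  rw [mul_sub, mul_one] at this
  exact this.two_dvd

omit [DecidableEq V] in
theorem two_dvd_dotProduct_self_sub (x : V → ℤ) : 2 ∣ x ⬝ᵥ x - ∑ v, x v := by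
  simpa [dotProduct] using two_dvd_sum_mul_sq_sub 1 x

variable {G}

/-- On eigenvectors of the signless Laplacian, the quadratic form of the Laplacian is known modulo
`4`: the two forms differ by twice the form of the adjacency matrix, which is even. -/
theorem four_dvd_dotProduct_lapMatrix_mulVec {k : ℤ} {x : V → ℤ}
    (hx : G.signlessLapMatrix ℤ *ᵥ x = k • x) :
    4 ∣ x ⬝ᵥ (G.lapMatrix ℤ *ᵥ x) - k * (x ⬝ᵥ x) := by
  rw [lapMatrix_mulVec_eq_signless, hx, dotProduct_sub, dotProduct_smul, dotProduct_smul,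
    smul_eq_mul, smul_eq_mul]
  have := G.even_dotProduct_adjMatrix_mulVec x
  omega

/-- The obstruction supplied by the number of spanning trees: a vector with even sum, in the kernel
of the Laplacian modulo `2` and isotropic modulo `4`, is zero modulo `2`. -/
theorem two_dvd_of_sum_even_of_lapMatrix (hM : ¬ 4 ∣ G.lapAddOnes.det) {z : V → ℤ}
    (hs : 2 ∣ ∑ v, z v) (heven : ∀ v, 2 ∣ (G.lapMatrix ℤ *ᵥ z) v)
    (hquad : 4 ∣ z ⬝ᵥ (G.lapMatrix ℤ *ᵥ z)) (v : V) : 2 ∣ z v := by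
  by_contra hv
  refine hM (four_dvd_det_of_isSymm G.isSymm_lapAddOnes ⟨v, hv⟩ (fun w => ?_) ?_)
  · rw [lapAddOnes_mulVec]
    exact dvd_add (heven w) hs
  · have h : z ⬝ᵥ (fun _ => ∑ w, z w) = (∑ w, z w) * ∑ w, z w := by
      simp [dotProduct, sum_mul]
    rw [lapAddOnes_mulVec, dotProduct_add, h]
    exact dvd_add hquad (mul_dvd_mul hs hs)

theorem lapMatrix_mulVec_ne_smul (hM : ¬ 4 ∣ G.lapAddOnes.det) {k : ℤ} (hk0 : k ≠ 0)
    (hk : 2 ∣ k) {x : V → ℤ} (hodd : ∃ i, ¬ 2 ∣ x i) : G.lapMatrix ℤ *ᵥ x ≠ k • x := by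
  intro hx
  have hs : ∑ v, x v = 0 := by
    have h1 : ∑ v, (G.lapMatrix ℤ *ᵥ x) v = 0 := by
      simp only [mulVec, dotProduct]
      rw [sum_comm]
      exact sum_eq_zero fun w _ => by rw [← sum_mul, G.sum_lapMatrix_col, zero_mul]
    rw [hx] at h1
    simp only [Pi.smul_apply, ← smul_sum] at h1
    exact (smul_eq_zero.1 h1).resolve_left hk0
  obtain ⟨i, hi⟩ := hodd
  refine hi (two_dvd_of_sum_even_of_lapMatrix hM (hs ▸ dvd_zero 2) (fun v => ?_) ?_ i)
  · rw [hx]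
    exact hk.mul_right _
  · rw [hx, dotProduct_smul]
    have := two_dvd_dotProduct_self_sub x
    rw [hs, sub_zero] at this
    exact mul_dvd_mul hk this

/-- An eigenvector of the signless Laplacian for an even eigenvalue has odd coordinate sum, unless
it vanishes modulo `2`. -/
theorem not_two_dvd_sum_of_signlessLapMatrix (hM : ¬ 4 ∣ G.lapAddOnes.det) {k : ℤ}
    (hk : 2 ∣ k) {x : V → ℤ} (hodd : ∃ i, ¬ 2 ∣ x i)
    (hx : G.signlessLapMatrix ℤ *ᵥ x = k • x) : ¬ 2 ∣ ∑ v, x v := by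
  intro hs
  obtain ⟨i, hi⟩ := hodd
  refine hi (two_dvd_of_sum_even_of_lapMatrix hM hs (fun v => ?_) ?_ i)
  · rw [lapMatrix_mulVec_eq_signless, hx]
    exact dvd_sub (hk.mul_right _) (Dvd.intro _ rfl)
  · have h1 := two_dvd_dotProduct_self_sub x
    have h2 : 4 ∣ k * (x ⬝ᵥ x) := mul_dvd_mul hk ((dvd_iff_dvd_of_dvd_sub h1).2 hs)
    exact (dvd_iff_dvd_of_dvd_sub (four_dvd_dotProduct_lapMatrix_mulVec hx)).2 h2

/-- Summing the eigenvector equation over all vertices gives `k ∑ xᵥ = 2 ∑ dᵥ xᵥ`. The left sum is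
odd and `∑ dᵥ xᵥ ≡ ∑ dᵥ xᵥ²` is even, so `4 ∣ k`. -/
theorem four_dvd_of_signlessLapMatrix_mulVec (hM : ¬ 4 ∣ G.lapAddOnes.det) {k : ℤ}
    (hk : 2 ∣ k) {x : V → ℤ} (hodd : ∃ i, ¬ 2 ∣ x i)
    (hx : G.signlessLapMatrix ℤ *ᵥ x = k • x) : 4 ∣ k := by
  have hs := not_two_dvd_sum_of_signlessLapMatrix hM hk hodd hx
  have h1 := G.sum_signlessLapMatrix_mulVec x
  have h2 : 2 ∣ ∑ v, G.degree v * (x v * x v) := by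
    have h3 : x ⬝ᵥ (G.signlessLapMatrix ℤ *ᵥ x) =
        ∑ v, G.degree v * (x v * x v) + x ⬝ᵥ (G.adjMatrix ℤ *ᵥ x) := by
      rw [signlessLapMatrix_eq_degMatrix_add_adjMatrix, add_mulVec, dotProduct_add,
        dotProduct_mulVec_degMatrix]
      simp only [mul_assoc]
    rw [hx, dotProduct_smul] at h3
    rw [← dvd_add_left (G.even_dotProduct_adjMatrix_mulVec x), ← h3]
    exact hk.mul_right _
  have h4 := (dvd_iff_dvd_of_dvd_sub (two_dvd_sum_mul_sq_sub (fun v => (G.degree v : ℤ)) x)).1 h2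
  rw [hx] at h1
  simp only [Pi.smul_apply, smul_eq_mul, ← mul_sum] at h1
  have hcop : IsCoprime (4 : ℤ) (∑ v, x v) := by
    simpa using ((Int.prime_two.coprime_iff_not_dvd).2 hs).pow_left (m := 2)
  refine hcop.dvd_of_dvd_mul_right ?_
  rw [h1]
  exact mul_dvd_mul_left 2 h4

/-- For an eigenvalue divisible by `4`, subtracting the all-ones vector from the eigenvector gives
a vector of even sum, to which the obstruction applies; so all coordinates are odd. -/
theorem not_two_dvd_apply_of_signlessLapMatrix_mulVec (hcard : Odd (Fintype.card V))
    (hM : ¬ 4 ∣ G.lapAddOnes.det) {k : ℤ} (hk : 4 ∣ k) {x : V → ℤ} (hodd : ∃ i, ¬ 2 ∣ x i)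
    (hx : G.signlessLapMatrix ℤ *ᵥ x = k • x) (v : V) : ¬ 2 ∣ x v := by
  have hk2 : 2 ∣ k := Dvd.dvd.trans (by norm_num) hk
  have hs := not_two_dvd_sum_of_signlessLapMatrix hM hk2 hodd hx
  have hL1 : G.lapMatrix ℤ *ᵥ (fun _ => 1) = 0 := G.lapMatrix_mulVec_const_eq_zero
  have hLz : G.lapMatrix ℤ *ᵥ (x - fun _ => 1) = G.lapMatrix ℤ *ᵥ x := by
    rw [mulVec_sub, hL1, sub_zero]
  have h1L : (fun _ => (1 : ℤ)) ⬝ᵥ (G.lapMatrix ℤ *ᵥ x) = 0 := by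
    rw [dotProduct_mulVec, ← mulVec_transpose, (G.isSymm_lapMatrix ℤ).eq, hL1, zero_dotProduct]
  have h := two_dvd_of_sum_even_of_lapMatrix hM (z := x - fun _ => 1) ?_ (fun w => ?_) ?_ v
  · simp only [Pi.sub_apply] at h
    omega
  · obtain ⟨m, hm⟩ := hcard
    simp only [Pi.sub_apply, sum_sub_distrib, sum_const, card_univ, hm, nsmul_eq_mul]
    push_cast
    omega
  · rw [hLz, lapMatrix_mulVec_eq_signless, hx]
    exact dvd_sub (hk2.mul_right _) (Dvd.intro _ rfl)
  · rw [hLz, sub_dotProduct, h1L, sub_zero]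
    exact (dvd_iff_dvd_of_dvd_sub (four_dvd_dotProduct_lapMatrix_mulVec hx)).2 (hk.mul_right _)

theorem not_four_dvd_det_lapAddOnes (hcard : Odd (Fintype.card V))
    (htau : ¬ 4 ∣ G.numSpanningTrees) : ¬ 4 ∣ G.lapAddOnes.det := by
  have : Nonempty V := Fintype.card_pos_iff.1 hcard.pos
  rw [lapAddOnes, det_lapMatrix_add_one_eq]
  intro h
  apply htau
  have hc : Nat.Coprime 4 (Fintype.card V ^ 2) :=
    Nat.Coprime.pow 2 2 (Nat.coprime_two_left.2 hcard)
  exact hc.dvd_of_dvd_mul_left (by exact_mod_cast h)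

end SimpleGraph

/-! ### Eigenvalues over the reals -/

theorem mainTheorem1 {V : Type*} [Fintype V] [DecidableEq V] (G : SimpleGraph V)
    [DecidableRel G.Adj] (hconn : G.Connected) (hodd : Odd (Fintype.card V))
    (htau : ¬ 4 ∣ G.numSpanningTrees) :
    -- (i) the Laplacian matrix has no nonzero even integer eigenvalue
    (∀ k : ℤ, k ≠ 0 → Even k →
      ¬ Module.End.HasEigenvalue (Matrix.toLin' (G.lapMatrix ℝ)) (k : ℝ)) ∧
    -- (ii) the signless Laplacian matrix has no integer eigenvalue congruent to 2 modulo 4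
    (∀ k : ℤ, k ≡ 2 [ZMOD 4] →
      ¬ Module.End.HasEigenvalue (Matrix.toLin' (G.signlessLapMatrix ℝ)) (k : ℝ)) ∧
    -- (iii) it has at most one integer eigenvalue divisible by 4 ...
    (∀ k l : ℤ, k ≡ 0 [ZMOD 4] → l ≡ 0 [ZMOD 4] →
      Module.End.HasEigenvalue (Matrix.toLin' (G.signlessLapMatrix ℝ)) (k : ℝ) →
      Module.End.HasEigenvalue (Matrix.toLin' (G.signlessLapMatrix ℝ)) (l : ℝ) → k = l) ∧
    -- ... and such an eigenvalue is simple
    (∀ k : ℤ, k ≡ 0 [ZMOD 4] →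
      Module.End.HasEigenvalue (Matrix.toLin' (G.signlessLapMatrix ℝ)) (k : ℝ) →
      (G.signlessLapMatrix ℝ).charpoly.rootMultiplicity (k : ℝ) = 1) := by
  have hM := SimpleGraph.not_four_dvd_det_lapAddOnes hodd htau
  refine ⟨fun k hk0 hk h => ?_, fun k hk h => ?_, fun k l hk hl h h' => ?_, fun k hk h => ?_⟩
  · obtain ⟨x, hx, hLx⟩ := exists_int_eigenvector G.map_lapMatrix h
    exact SimpleGraph.lapMatrix_mulVec_ne_smul hM hk0 hk.two_dvd hx hLx
  · obtain ⟨x, hx, hQx⟩ := exists_int_eigenvector G.map_signlessLapMatrix h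
    rw [Int.ModEq] at hk
    have := SimpleGraph.four_dvd_of_signlessLapMatrix_mulVec hM (by omega) hx hQx
    omega
  · obtain ⟨x, hx, hQx⟩ := exists_int_eigenvector G.map_signlessLapMatrix h
    obtain ⟨y, hy, hQy⟩ := exists_int_eigenvector G.map_signlessLapMatrix h'
    have hx' := SimpleGraph.not_two_dvd_apply_of_signlessLapMatrix_mulVec hodd hM
      (Int.modEq_zero_iff_dvd.1 hk) hx hQx
    have hy' := SimpleGraph.not_two_dvd_apply_of_signlessLapMatrix_mulVec hodd hM
      (Int.modEq_zero_iff_dvd.1 hl) hy hQy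
    by_contra hkl
    -- eigenvectors for distinct eigenvalues are orthogonal
    have h1 : x ⬝ᵥ (G.signlessLapMatrix ℤ *ᵥ y) = (G.signlessLapMatrix ℤ *ᵥ x) ⬝ᵥ y := by
      rw [dotProduct_mulVec, ← mulVec_transpose, G.isSymm_signlessLapMatrix.eq]
    rw [hQx, hQy, dotProduct_smul, smul_dotProduct, smul_eq_mul, smul_eq_mul] at h1
    have h2 : x ⬝ᵥ y = 0 :=
      (mul_eq_zero.1 (show (k - l) * (x ⬝ᵥ y) = 0 by linarith)).resolve_left (sub_ne_zero.2 hkl)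
    -- a sum of an odd number of odd products is odd, hence nonzero
    have h3 : 2 ∣ ∑ v, (x v * y v - 1) := dvd_sum fun v _ => by
      have hx2 : Odd (x v) := Int.not_even_iff_odd.1 fun h => hx' v h.two_dvd
      have hy2 : Odd (y v) := Int.not_even_iff_odd.1 fun h => hy' v h.two_dvd
      exact ((hx2.mul hy2).sub_odd odd_one).two_dvd
    have h4 : ∑ v, x v * y v = 0 := h2
    obtain ⟨m, hm⟩ := hodd
    rw [sum_sub_distrib, h4, sum_const, card_univ, hm, nsmul_eq_mul] at h3
    push_cast at h3
    omega
  · have hpos : 0 < (G.signlessLapMatrix ℝ).charpoly.rootMultiplicity (k : ℝ) := by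
      rw [Polynomial.rootMultiplicity_pos (charpoly_monic _).ne_zero]
      rw [Module.End.hasEigenvalue_iff_isRoot_charpoly, charpoly_toLin'] at h
      exact h
    refine le_antisymm (not_lt.1 fun hlt => ?_) hpos
    obtain ⟨i⟩ : Nonempty V := hconn.nonempty
    obtain ⟨x, hx0, hQx, hxi⟩ :=
      G.isHermitian_signlessLapMatrix.exists_eigenvector_apply_eq_zero hlt i
    obtain ⟨y, hy, hQy, hyi⟩ := exists_int_eigenvector_of_apply_eq_zero
      G.isSymm_signlessLapMatrix G.map_signlessLapMatrix hx0 hQx hxi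
    exact SimpleGraph.not_two_dvd_apply_of_signlessLapMatrix_mulVec hodd hM
      (Int.modEq_zero_iff_dvd.1 hk) hy hQy i (hyi ▸ dvd_zero 2)
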